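/- There are $K$ strata, $I$ ordered treatment levels and two outcome levels $1,2$; stratum $k$ has $N_k$ subjects. Subject $s$ of stratum $k$ has a random treatment $Z_{ks}\in\{1,\dots,I\}$, fixed potential outcomes $r_{ks}^{(1)},\dots,r_{ks}^{(I)}\in\{1,2\}$, observed outcome $r_{ks}^{(Z_{ks})}$, observed covariate $x_{ks}$, the same for all subjects of a stratum, and unobserved covariate $u_{ks}\in[0,1]$. Let $\delta_1\le\dots\le\delta_I$ with $\delta_i\in\{0,1\}$, and let $0\le\gamma_0\le\gamma$ (so the actual bias $e^{\gamma_0}$ is at most $\Gamma=e^{\gamma}$). Assume that the $Z_{ks}$ are mutually independent, within and across strata, and follow the generic-bias model $$\mathbb{P}(Z_{ks}=i)=\frac{\exp\{\xi_i(x_{ks})+\gamma_0\delta_i u_{ks}\}}{\sum_{i'=1}^{I}\exp\{\xi_{i'}(x_{ks})+\gamma_0\delta_{i'}u_{ks}\}}$$ for real-valued functions $\xi_1,\dots,\xi_I$. Assume the joint sharp null hypothesis $r_{ks}^{(1)}=\dots=r_{ks}^{(I)}=:r_{ks}$ for all $k,s$, and let $N_{(k)\cdot 2}$ be the number of $s$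 with $r_{ks}=2$. For each $k$ let $N_{(k)1\cdot},\dots,N_{(k)I\cdot}$ be nonnegative integers with sum $N_k$, and let $E$ be the event that, for all $k$ and $i$, exactly $N_{(k)i\cdot}$ subjects of stratum $k$ receive treatment $i$. For real scores $\alpha_{(k)1}\le\dots\le\alpha_{(k)I}$ let $T_k=\sum_{i=1}^I\alpha_{(k)i}N_{(k)i2}$, where $N_{(k)i2}$ is the number of subjects of stratum $k$ with treatment $i$ and observed outcome $2$. Let $M_{(1)},\dots,M_{(K)}$ be independent random vectors, $M_{(k)}$ having the multivariate extended hypergeometric distribution: for $t\in\mathbb{Z}_{\ge0}^I$ with $\sum_i t_i=N_{(k)\cdot2}$, $$\mathbb{P}(M_{(k)}=t)=\frac{\prod_{i=1}^I\binom{N_{(k)i\cdot}}{t_i}e^{\gamma\delta_i t_i}}{\sum_{q}\prod_{i=1}^I\binom{N_{(k)i\cdot}}{q_i}e^{\gamma\delta_i q_i}},$$ the sum running over all $q\in\mathbb{Z}_{\ge0}^I$ with $\sum_i q_i=N_{(k)\cdot2}$, and $\mathbb{P}(M_{(k)}=t)=0$ for all other $t$. Let $\overline T_k=\sum_{i=1}^I\alpha_{(k)i}M_{(k)i}$.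 Let $g:\mathbb{R}^K\to\mathbb{R}$ be monotone increasing (nondecreasing in each variable). Then $$\mathbb{P}\bigl(g(T_1,\dots,T_K)\ge c\mid E\bigr)\le\mathbb{P}\bigl(g(\overline T_1,\dots,\overline T_K)\ge c\bigr)\qquad\text{for all } c\in\mathbb{R}.$$ -/

import Mathlib

open MeasureTheory ProbabilityTheory

/-- The observed outcomes `r_s = r_s^{(z_s)}` of `n` subjects with potential outcomes
`Y s i = r_s^{(i)}` under the treatment assignment `z`. -/
def observedOutcome {n I J : ℕ} (Y : Fin n → Fin I → Fin J) (z : Fin n → Fin I) :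
    Fin n → Fin J :=
  fun s => Y s (z s)

/-- The cell count `N_{ij}`: the number of subjects with treatment `i` and outcome `j`. -/
def cellCount {n I J : ℕ} (z : Fin n → Fin I) (r : Fin n → Fin J) (i : Fin I) (j : Fin J) : ℕ :=
  (Finset.univ.filter fun s => z s = i ∧ r s = j).card

/-- The treatment margin `N_{i·}`: the number of subjects with treatment `i`. -/
def treatmentMargin {n I : ℕ} (z : Fin n → Fin I) (i : Fin I) : ℕ :=
  (Finset.univ.filter fun s => z s = i).card

/-- The outcome margin `N_{·j}`: the number of subjects with outcome `j`. -/
def outcomeMargin {n J : ℕ} (r : Fin n → Fin J) (j : Fin J) : ℕ :=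
  (Finset.univ.filter fun s => r s = j).card

/-- The sign-score statistic `∑ i, α_i N_{i2}` of an `I × 2` table. The two outcome levels
`1, 2` are the elements `0, 1` of `Fin 2`. -/
noncomputable def signScore {n I : ℕ} (α : Fin I → ℝ) (z : Fin n → Fin I) (r : Fin n → Fin 2) :
    ℝ :=
  ∑ i, α i * (cellCount z r i 1 : ℝ)

/-- The multinomial logistic probability of treatment `i` for a subject with observed
covariate `x` and unobserved covariate `u`, in the generic-bias model with sensitivity
parameter `γ`. -/
noncomputable def genericBiasProb {I : ℕ} {X : Type*} (ξ : Fin I → X → ℝ) (δ : Fin I → ℝ)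
    (γ : ℝ) (x : X) (u : ℝ) (i : Fin I) : ℝ :=
  Real.exp (ξ i x + γ * δ i * u) / ∑ i', Real.exp (ξ i' x + γ * δ i' * u)

/-- The random treatments `Z k s` of the subjects `s` of the strata `k` follow the generic-bias
model with sensitivity parameter `γ`: the observed covariate is constant within each stratum,
the unobserved one lies in `[0, 1]`, all treatments are mutually independent (within and across
strata), and each has the multinomial logistic distribution. -/
structure FollowsGenericBias {Ω : Type*} [MeasurableSpace Ω] (P : Measure Ω) {K I : ℕ}
    {n : Fin K → ℕ} {X : Type*} (Z : (k : Fin K) → Fin (n k) → Ω → Fin I)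
    (ξ : Fin I → X → ℝ) (δ : Fin I → ℝ) (γ : ℝ)
    (x : (k : Fin K) → Fin (n k) → X) (u : (k : Fin K) → Fin (n k) → ℝ) : Prop where
  same_covariate : ∀ k s s', x k s = x k s'
  unobserved_mem : ∀ k s, u k s ∈ Set.Icc (0 : ℝ) 1
  measurable_treatment : ∀ k s, Measurable (Z k s)
  indep : iIndepFun (fun ks : (Σ k, Fin (n k)) => Z ks.1 ks.2) P
  prob : ∀ k s i, P.real {ω | Z k s ω = i} = genericBiasProb ξ δ γ (x k s) (u k s) i

/-- The event that, in every stratum `k`, the treatment margins are the prescribed `m k`. -/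
def marginEvent {Ω : Type*} {K I : ℕ} {n : Fin K → ℕ}
    (Z : (k : Fin K) → Fin (n k) → Ω → Fin I) (m : Fin K → Fin I → ℕ) : Set Ω :=
  {ω | ∀ k i, treatmentMargin (fun s => Z k s ω) i = m k i}

/-- The probability mass function of the multivariate extended hypergeometric distribution with
margins `m`, sample size `d` and log-weights `w`, i.e. `∏ i, C(m_i, t_i) exp(w_i t_i)`, on the
vectors `t` of nonnegative integers with sum `d`, divided by the sum of these products over all
such vectors. -/
noncomputable def extHypergeomMass {I : ℕ} (m : Fin I → ℕ) (d : ℕ) (w : Fin I → ℝ)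
    (t : Fin I → ℕ) : ℝ :=
  if ∑ i, t i = d then
    (∏ i, ((m i).choose (t i) : ℝ) * Real.exp (w i * t i)) /
      ∑ q ∈ Finset.piAntidiag Finset.univ d,
        ∏ i, ((m i).choose (q i) : ℝ) * Real.exp (w i * q i)
  else 0

/-- `M` is a random vector with the multivariate extended hypergeometric distribution. -/
structure HasExtHypergeomLaw {Ω : Type*} [MeasurableSpace Ω] (Q : Measure Ω) {I : ℕ}
    (M : Ω → Fin I → ℕ) (m : Fin I → ℕ) (d : ℕ) (w : Fin I → ℝ) : Prop where
  measurable : Measurable M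
  mass : ∀ t, Q.real {ω | M ω = t} = extHypergeomMass m d w t

section Swap

set_option linter.unusedSectionVars false

variable {S : Type*} [Fintype S] [DecidableEq S]

/-- The indicator function of a Boolean vector, with values in `ℝ`. -/
def boolVal (b : Bool) : ℝ := if b then 1 else 0

@[simp] lemma boolVal_true : boolVal true = 1 := rfl

@[simp] lemma boolVal_false : boolVal false = 0 := rfl

lemma sum_mul_comp_swap (c a : S → ℝ) (s s' : S) :
    ∑ t, c t * a (Equiv.swap s s' t) = ∑ t, c t * a t + (c s - c s') * (a s' - a s) := by
  rcases eq_or_ne s s' with rfl | h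
  · simp
  have key : ∑ t, (c t * a (Equiv.swap s s' t) - c t * a t) =
      ∑ t ∈ {s, s'}, (c t * a (Equiv.swap s s' t) - c t * a t) := by
    symm
    apply Finset.sum_subset (Finset.subset_univ _)
    intro t _ ht
    simp only [Finset.mem_insert, Finset.mem_singleton, not_or] at ht
    rw [Equiv.swap_apply_of_ne_of_ne ht.1 ht.2, sub_self]
  rw [Finset.sum_sub_distrib, Finset.sum_pair h, Equiv.swap_apply_left,
    Equiv.swap_apply_right] at key
  linarith

/-- The number of `true` entries of `b` inside the set `{ρ = true}`, as a real number. -/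
noncomputable def level (ρ b : S → Bool) : ℝ := ∑ t, boolVal (ρ t) * boolVal (b t)

/-- A function of Boolean vectors that does not decrease when a `true` entry at `s'` is exchanged
with a `false` entry at `s`, unless this leaves the set `{ρ = true}`. -/
def SwapMonotone (ρ : S → Bool) (F : (S → Bool) → ℝ) : Prop :=
  ∀ b s s', b s' = true → b s = false → (ρ s' = true → ρ s = true) →
    F b ≤ F (b ∘ Equiv.swap s s')

lemma exists_of_sum_le {ρ b b' : S → Bool} (h : level ρ b ≤ level ρ b') {s : S}
    (hρ : ρ s = true) (hb : b s = true) (hb' : b' s = false) :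
    ∃ t, ρ t = true ∧ b t = false ∧ b' t = true := by
  by_contra! hc
  refine absurd h (not_le.2 ?_)
  refine Finset.sum_lt_sum (fun t _ => ?_) ⟨s, Finset.mem_univ s, by simp [hρ, hb, hb']⟩
  have := hc t
  cases h1 : ρ t <;> cases h2 : b t <;> cases h3 : b' t <;> simp_all

lemma level_comp_swap (ρ b : S → Bool) (s s' : S) :
    level ρ (b ∘ Equiv.swap s s') =
      level ρ b + (boolVal (ρ s) - boolVal (ρ s')) * (boolVal (b s') - boolVal (b s)) :=
  sum_mul_comp_swap (fun t => boolVal (ρ t)) (fun t => boolVal (b t)) s s'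

lemma SwapMonotone.le_of_level_le {ρ : S → Bool} {F : (S → Bool) → ℝ} (hF : SwapMonotone ρ F)
    {b b' : S → Bool} (hcard : level (fun _ => true) b = level (fun _ => true) b')
    (hlev : level ρ b ≤ level ρ b') : F b ≤ F b' := by
  induction hN : (Finset.univ.filter fun s => b s = true ∧ b' s = false).card using
    Nat.strong_induction_on generalizing b with
  | _ N ih =>
    -- one exchange of an entry of `b` outside `b'` for an entry of `b'` outside `b`
    have step : ∀ s s', b s' = true → b' s' = false → b s = false → b' s = true →
        (ρ s' = true → ρ s = true) →
        level ρ (b ∘ Equiv.swap s s') ≤ level ρ b' → F b ≤ F b' := by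
      intro s s' h1 h2 h3 h4 h5 h6
      refine (hF b s s' h1 h3 h5).trans (ih _ ?_ ?_ h6 rfl)
      · rw [← hN]
        apply Finset.card_lt_card
        rw [Finset.ssubset_iff_of_subset]
        · exact ⟨s', by simp [h1, h2], by simp [h3]⟩
        · intro t
          simp only [Finset.mem_filter, Finset.mem_univ, true_and, Function.comp]
          rintro ⟨h7, h8⟩
          refine ⟨?_, h8⟩
          rcases eq_or_ne t s with rfl | hs
          · simp_all
          rcases eq_or_ne t s' with rfl | hs'
          · exact h1
          · rwa [Equiv.swap_apply_of_ne_of_ne hs hs'] at h7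
      · rw [level_comp_swap, hcard]; simp
    by_cases c1 : ∃ s', ρ s' = true ∧ b s' = true ∧ b' s' = false
    · obtain ⟨s', h1, h2, h3⟩ := c1
      obtain ⟨s, h4, h5, h6⟩ := exists_of_sum_le hlev h1 h2 h3
      refine step s s' h2 h3 h5 h6 (fun _ => h4) ?_
      rw [level_comp_swap, h1, h4]; simpa using hlev
    push Not at c1
    by_cases c2 : ∃ s', b s' = true ∧ b' s' = false
    · obtain ⟨s', h2, h3⟩ := c2
      have h1 : ρ s' = false := by
        by_contra h
        exact c1 s' (by simpa using h) h2 h3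
      by_cases c3 : ∃ s, ρ s = false ∧ b s = false ∧ b' s = true
      · obtain ⟨s, h4, h5, h6⟩ := c3
        refine step s s' h2 h3 h5 h6 (by simp [h1]) ?_
        rw [level_comp_swap, h1, h4]; simpa using hlev
      · obtain ⟨s, -, h5, h6⟩ := exists_of_sum_le (ρ := fun _ => true) hcard.le rfl h2 h3
        refine step s s' h2 h3 h5 h6 (by simp [h1]) ?_
        refine Finset.sum_le_sum fun t _ => ?_
        rcases eq_or_ne t s with rfl | hs
        · simp [h2, h6]
        rcases eq_or_ne t s' with rfl | hs'
        · simp [h1]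
        have := c1 t
        simp only [Function.comp, Equiv.swap_apply_of_ne_of_ne hs hs']
        cases h7 : ρ t <;> cases h8 : b t <;> cases h9 : b' t <;> simp_all
    · push Not at c2
      apply le_of_eq
      congr 1
      funext t
      by_contra hne
      have hb : b t = false := by
        cases h8 : b t
        · rfl
        · have := c2 t h8; simp_all
      have hb' : b' t = true := by
        cases h8 : b' t
        · simp_all
        · rfl
      obtain ⟨s, -, h5, h6⟩ :=
        exists_of_sum_le (ρ := fun _ => true) hcard.ge rfl hb' hb
      exact c2 s h6 h5

lemma SwapMonotone.eq_of_level_eq {ρ : S → Bool} {F : (S → Bool) → ℝ} (hF : SwapMonotone ρ F)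
    {b b' : S → Bool} (hcard : level (fun _ => true) b = level (fun _ => true) b')
    (hlev : level ρ b = level ρ b') : F b = F b' :=
  le_antisymm (hF.le_of_level_le hcard hlev.le) (hF.le_of_level_le hcard.symm hlev.ge)

/-- The exponential weight of a Boolean vector. -/
noncomputable def expWeight (θ : S → ℝ) (b : S → Bool) : ℝ :=
  Real.exp (∑ t, θ t * boolVal (b t))

/-- The permutations that preserve the set `{ρ = true}`. -/
def preservingPerms (ρ : S → Bool) : Finset (Equiv.Perm S) :=
  Finset.univ.filter fun σ => ∀ s, ρ (σ s) = ρ s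

/-- The sum of the weights of all `b ∘ σ`, where `σ` preserves `{ρ = true}`. -/
noncomputable def symmWeight (ρ : S → Bool) (θ : S → ℝ) (b : S → Bool) : ℝ :=
  ∑ σ ∈ preservingPerms ρ, expWeight θ (b ∘ σ)

lemma level_comp_perm {ρ : S → Bool} {σ : Equiv.Perm S} (h : ∀ s, ρ (σ s) = ρ s)
    (b : S → Bool) : level ρ (b ∘ σ) = level ρ b := by
  unfold level
  rw [← Equiv.sum_comp σ (fun t => boolVal (ρ t) * boolVal (b t))]
  simp [h]

lemma expWeight_comp_swap_le {θ : S → ℝ} {γ : ℝ} (hθ : ∀ s, θ s ∈ Set.Icc 0 γ) (b : S → Bool)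
    (s s' : S) : expWeight θ (b ∘ Equiv.swap s s') ≤ Real.exp γ * expWeight θ b := by
  unfold expWeight
  rw [← Real.exp_add]
  apply Real.exp_le_exp.2
  have := sum_mul_comp_swap θ (fun t => boolVal (b t)) s s'
  simp only [Function.comp] at this ⊢
  rw [this]
  obtain ⟨h1, h2⟩ := hθ s
  obtain ⟨h3, h4⟩ := hθ s'
  cases b s <;> cases b s' <;> simp <;> linarith

lemma symmWeight_comp_swap_le {ρ : S → Bool} {θ : S → ℝ} {γ : ℝ} (hθ : ∀ s, θ s ∈ Set.Icc 0 γ)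
    (b : S → Bool) (s s' : S) :
    symmWeight ρ θ (b ∘ Equiv.swap s s') ≤ Real.exp γ * symmWeight ρ θ b := by
  unfold symmWeight
  rw [Finset.mul_sum]
  refine Finset.sum_le_sum fun σ _ => ?_
  have : (b ∘ Equiv.swap s s') ∘ σ = (b ∘ σ) ∘ Equiv.swap (σ.symm s) (σ.symm s') := by
    funext t
    simp only [Function.comp]
    congr 1
    simp only [Equiv.swap_apply_def, Equiv.eq_symm_apply]
    split_ifs <;> simp
  rw [this]
  exact expWeight_comp_swap_le hθ _ _ _

lemma symmWeight_comp_perm {ρ : S → Bool} {θ : S → ℝ} {τ : Equiv.Perm S}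
    (h : ∀ s, ρ (τ s) = ρ s) (b : S → Bool) :
    symmWeight ρ θ (b ∘ τ) = symmWeight ρ θ b := by
  unfold symmWeight
  refine Finset.sum_bij' (fun σ _ => τ * σ) (fun σ _ => τ⁻¹ * σ) ?_ ?_ ?_ ?_ ?_
  · intro σ hσ
    simp_all [preservingPerms]
  · intro σ hσ
    simp only [preservingPerms, Finset.mem_filter, Finset.mem_univ, true_and] at hσ ⊢
    intro s
    rw [← hσ s, ← h ((τ⁻¹ * σ) s)]
    simp
  · simp
  · simp
  · intro σ _
    rfl

lemma swapMonotone_neg_symmWeight_div {ρ : S → Bool} {θ : S → ℝ} {γ : ℝ}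
    (hθ : ∀ s, θ s ∈ Set.Icc 0 γ) :
    SwapMonotone ρ fun b => -(symmWeight ρ θ b / Real.exp (γ * level ρ b)) := by
  intro b s s' hs' hs hρ
  rw [neg_le_neg_iff]
  by_cases h : ρ s = ρ s'
  · have hp : ∀ t, ρ (Equiv.swap s s' t) = ρ t := by
      intro t
      rcases eq_or_ne t s with rfl | h1
      · simp [h]
      rcases eq_or_ne t s' with rfl | h2
      · simp [h]
      · rw [Equiv.swap_apply_of_ne_of_ne h1 h2]
    rw [symmWeight_comp_perm hp, level_comp_perm hp]
  · have h1 : ρ s' = false := by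
      by_contra h1
      simp_all
    have h2 : ρ s = true := by
      by_contra h2
      simp_all
    rw [level_comp_swap, h1, h2, hs, hs', div_le_div_iff₀ (Real.exp_pos _) (Real.exp_pos _)]
    have := symmWeight_comp_swap_le (ρ := ρ) hθ b s s'
    simp only [boolVal_true, boolVal_false, sub_zero, mul_one, mul_add, Real.exp_add]
    calc _ ≤ (Real.exp γ * symmWeight ρ θ b) * Real.exp (γ * level ρ b) := by gcongr
      _ = _ := by ring

/-- Boolean vectors with the given number of `true` entries. -/
noncomputable def layer (S : Type*) [Fintype S] [DecidableEq S] (a : ℝ) : Finset (S → Bool) :=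
  Finset.univ.filter fun b => level (fun _ => true) b = a

lemma sum_symmWeight_mul {ρ : S → Bool} {θ : S → ℝ} {h : (S → Bool) → ℝ}
    (hh : SwapMonotone ρ h) (a : ℝ) :
    ∑ b ∈ layer S a, symmWeight ρ θ b * h b =
      (preservingPerms ρ).card * ∑ b ∈ layer S a, expWeight θ b * h b := by
  simp only [symmWeight, Finset.sum_mul]
  rw [Finset.sum_comm, ← nsmul_eq_mul, ← Finset.sum_const]
  refine Finset.sum_congr rfl fun σ hσ => ?_
  simp only [preservingPerms, Finset.mem_filter, Finset.mem_univ, true_and] at hσ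
  have hl : ∀ (τ : Equiv.Perm S) (b : S → Bool),
      level (fun _ => true) (b ∘ τ) = level (fun _ => true) b :=
    fun τ b => level_comp_perm (fun _ => rfl) b
  refine Finset.sum_bij' (fun b _ => b ∘ σ) (fun b _ => b ∘ σ.symm) ?_ ?_ ?_ ?_ ?_
  · intro b hb
    simpa [layer, hl] using hb
  · intro b hb
    simpa [layer, hl] using hb
  · intro b _; funext t; simp
  · intro b _; funext t; simp
  · intro b _
    rw [hh.eq_of_level_eq (hl σ b) (level_comp_perm hσ b)]

/-- Chebyshev's sum inequality for two oppositely ordered functions, in weighted form. -/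
lemma sum_mul_sum_le_of_forall {ι : Type*} (s : Finset ι) (p q h : ι → ℝ)
    (H : ∀ x ∈ s, ∀ y ∈ s, 0 ≤ (p x * q y - p y * q x) * (h y - h x)) :
    (∑ x ∈ s, p x * h x) * ∑ x ∈ s, q x ≤ (∑ x ∈ s, q x * h x) * ∑ x ∈ s, p x := by
  have h0 : 0 ≤ ∑ x ∈ s, ∑ y ∈ s, (p x * q y - p y * q x) * (h y - h x) :=
    Finset.sum_nonneg fun x hx => Finset.sum_nonneg fun y hy => H x hx y hy
  have h1 : ∑ x ∈ s, ∑ y ∈ s, (p x * q y - p y * q x) * (h y - h x) =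
      ∑ x ∈ s, ∑ y ∈ s, (p x * (q y * h y) - (p x * h x) * q y
        - (q x * (p y * h y)) + (q x * h x) * p y) :=
    Finset.sum_congr rfl fun x _ => Finset.sum_congr rfl fun y _ => by ring
  rw [h1] at h0
  simp only [Finset.sum_add_distrib, Finset.sum_sub_distrib, ← Finset.sum_mul_sum] at h0
  linarith

lemma layer_sum_le {ρ : S → Bool} {θ : S → ℝ} {γ : ℝ} (hθ : ∀ s, θ s ∈ Set.Icc 0 γ)
    {h : (S → Bool) → ℝ} (hh : SwapMonotone ρ h) (a : ℝ) :
    (∑ b ∈ layer S a, expWeight θ b * h b) * ∑ b ∈ layer S a, Real.exp (γ * level ρ b) ≤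
      (∑ b ∈ layer S a, Real.exp (γ * level ρ b) * h b) * ∑ b ∈ layer S a, expWeight θ b := by
  have hpos : (0 : ℝ) < (preservingPerms ρ).card := by
    rw [Nat.cast_pos, Finset.card_pos]
    exact ⟨1, by simp [preservingPerms]⟩
  have hlayer : ∀ x ∈ layer S a, ∀ y ∈ layer S a,
      level (fun _ => true) x = level (fun _ => true) y := by
    intro x hx y hy
    simp only [layer, Finset.mem_filter, Finset.mem_univ, true_and] at hx hy
    rw [hx, hy]
  have key := sum_mul_sum_le_of_forall (layer S a) (symmWeight ρ θ)
    (fun b => Real.exp (γ * level ρ b)) h ?_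
  · have h1 := sum_symmWeight_mul (θ := θ) hh a
    have h2 := sum_symmWeight_mul (θ := θ) (ρ := ρ) (h := fun _ => 1)
      (fun _ _ _ _ _ _ => le_rfl) a
    simp only [mul_one] at h2
    rw [h1, h2] at key
    refine le_of_mul_le_mul_left ?_ hpos
    linarith
  · have main : ∀ x ∈ layer S a, ∀ y ∈ layer S a, level ρ x ≤ level ρ y →
        0 ≤ (symmWeight ρ θ x * Real.exp (γ * level ρ y) -
          symmWeight ρ θ y * Real.exp (γ * level ρ x)) * (h y - h x) := by
      intro x hx y hy hxy
      have h1 := hh.le_of_level_le (hlayer x hx y hy) hxy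
      have h2 := (swapMonotone_neg_symmWeight_div hθ).le_of_level_le (hlayer x hx y hy) hxy
      rw [neg_le_neg_iff, div_le_div_iff₀ (Real.exp_pos _) (Real.exp_pos _)] at h2
      exact mul_nonneg (by linarith) (by linarith)
    intro x hx y hy
    rcases le_total (level ρ x) (level ρ y) with hxy | hxy
    · exact main x hx y hy hxy
    · have := main y hy x hx hxy
      nlinarith

end Swap

/-- The treatment assignments with the prescribed treatment margins. -/
def marginSet (n : ℕ) {I : ℕ} (m : Fin I → ℕ) : Finset (Fin n → Fin I) :=
  Finset.univ.filter fun z => ∀ i, treatmentMargin z i = m i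

lemma mem_marginSet {n I : ℕ} {m : Fin I → ℕ} {z : Fin n → Fin I} :
    z ∈ marginSet n m ↔ ∀ i, treatmentMargin z i = m i := by
  simp [marginSet]

lemma sum_comp_eq_sum_treatmentMargin {n I : ℕ} (c : Fin I → ℝ) (z : Fin n → Fin I) :
    ∑ s, c (z s) = ∑ i, c i * treatmentMargin z i := by
  rw [← Finset.sum_fiberwise Finset.univ z]
  refine Finset.sum_congr rfl fun i _ => ?_
  rw [Finset.sum_congr rfl (g := fun _ => c i)]
  · simp [treatmentMargin, mul_comm]
  · intro s hs
    rw [(Finset.mem_filter.1 hs).2]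

lemma sum_mul_cellCount {n I J : ℕ} (c : Fin I → ℝ) (z : Fin n → Fin I) (r : Fin n → Fin J)
    (j : Fin J) :
    ∑ i, c i * cellCount z r i j = ∑ s, boolVal (decide (r s = j)) * c (z s) := by
  rw [← Finset.sum_fiberwise Finset.univ z]
  refine Finset.sum_congr rfl fun i _ => ?_
  rw [Finset.sum_congr rfl (g := fun s => if r s = j then c i else 0)]
  · rw [← Finset.sum_filter, Finset.sum_const, Finset.filter_filter, nsmul_eq_mul, mul_comm]
    rfl
  · intro s hs
    rw [(Finset.mem_filter.1 hs).2]
    simp [boolVal]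

lemma treatmentMargin_comp_perm {n I : ℕ} (z : Fin n → Fin I) (σ : Equiv.Perm (Fin n))
    (i : Fin I) : treatmentMargin (z ∘ σ) i = treatmentMargin z i := by
  refine Finset.card_bij' (fun s _ => σ s) (fun s _ => σ.symm s) ?_ ?_ ?_ ?_ <;> simp

lemma comp_perm_mem_marginSet {n I : ℕ} {m : Fin I → ℕ} {z : Fin n → Fin I}
    (hz : z ∈ marginSet n m) (σ : Equiv.Perm (Fin n)) : z ∘ σ ∈ marginSet n m := by
  rw [mem_marginSet] at hz ⊢
  intro i
  rw [treatmentMargin_comp_perm, hz]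

/-- The sum of `f` over the assignments with given margins that lie over the pattern `b`. -/
noncomputable def fiberSum {n I : ℕ} (m : Fin I → ℕ) (D : Fin I → Bool)
    (f : (Fin n → Fin I) → ℝ) (b : Fin n → Bool) : ℝ :=
  ∑ z ∈ (marginSet n m).filter (fun z => D ∘ z = b), f z

lemma swapMonotone_fiberSum {n I : ℕ} {m : Fin I → ℕ} {D : Fin I → Bool}
    {f : (Fin n → Fin I) → ℝ} {ρ : Fin n → Bool}
    (hf : ∀ z s s', D (z s') = true → D (z s) = false → (ρ s' = true → ρ s = true) →
      f z ≤ f (z ∘ Equiv.swap s s')) :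
    SwapMonotone ρ (fiberSum m D f) := by
  intro b s s' hs' hs hρ
  unfold fiberSum
  have : ∑ z ∈ (marginSet n m).filter (fun z => D ∘ z = b), f (z ∘ Equiv.swap s s') =
      ∑ z ∈ (marginSet n m).filter (fun z => D ∘ z = b ∘ Equiv.swap s s'), f z := by
    refine Finset.sum_bij' (fun z _ => z ∘ Equiv.swap s s') (fun z _ => z ∘ Equiv.swap s s')
      ?_ ?_ ?_ ?_ ?_
    · intro z hz
      rw [Finset.mem_filter] at hz ⊢
      exact ⟨comp_perm_mem_marginSet hz.1 _, by rw [← hz.2]; rfl⟩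
    · intro z hz
      rw [Finset.mem_filter] at hz ⊢
      refine ⟨comp_perm_mem_marginSet hz.1 _, ?_⟩
      rw [← Function.comp_assoc, hz.2]
      funext t; simp
    · intro z _; funext t; simp
    · intro z _; funext t; simp
    · intro z _; rfl
  rw [← this]
  refine Finset.sum_le_sum fun z hz => ?_
  have hb := (Finset.mem_filter.1 hz).2
  exact hf z s s' (by rw [← hs', ← hb]; rfl) (by rw [← hs, ← hb]; rfl) hρ

lemma sum_marginSet_eq {n I : ℕ} (m : Fin I → ℕ) (D : Fin I → Bool)
    (G : (Fin n → Bool) → ℝ) (f : (Fin n → Fin I) → ℝ) :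
    ∑ z ∈ marginSet n m, G (D ∘ z) * f z =
      ∑ b ∈ layer (Fin n) (∑ i, boolVal (D i) * m i), G b * fiberSum m D f b := by
  rw [← Finset.sum_fiberwise_of_maps_to (g := fun z : Fin n → Fin I => D ∘ z)
    (t := layer (Fin n) (∑ i, boolVal (D i) * m i))]
  · refine Finset.sum_congr rfl fun b _ => ?_
    rw [fiberSum, Finset.mul_sum]
    refine Finset.sum_congr rfl fun z hz => ?_
    rw [(Finset.mem_filter.1 hz).2]
  · intro z hz
    rw [mem_marginSet] at hz
    have := sum_comp_eq_sum_treatmentMargin (fun i => boolVal (D i)) z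
    simp only [hz] at this
    simpa [layer, level] using this

/-- Among all unobserved covariates, the tilt by `γ` along the outcome maximizes the expectation
of every nondecreasing function of a sign-score statistic given the treatment margins. -/
lemma tilted_sum_le {n I : ℕ} (m : Fin I → ℕ) {D : Fin I → Bool}
    (hD : ∀ i j, D i = false → D j = true → i ≤ j) {θ : Fin n → ℝ} {γ : ℝ}
    (hθ : ∀ s, θ s ∈ Set.Icc 0 γ) (ρ : Fin n → Bool) {α : Fin I → ℝ} (hα : Monotone α)
    {φ : ℝ → ℝ} (hφ : Monotone φ) :
    (∑ z ∈ marginSet n m, Real.exp (∑ s, θ s * boolVal (D (z s))) *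
        φ (∑ s, boolVal (ρ s) * α (z s))) *
      ∑ z ∈ marginSet n m, Real.exp (γ * ∑ s, boolVal (ρ s) * boolVal (D (z s))) ≤
    (∑ z ∈ marginSet n m, Real.exp (γ * ∑ s, boolVal (ρ s) * boolVal (D (z s))) *
        φ (∑ s, boolVal (ρ s) * α (z s))) *
      ∑ z ∈ marginSet n m, Real.exp (∑ s, θ s * boolVal (D (z s))) := by
  set a : ℝ := ∑ i, boolVal (D i) * m i with ha
  set f : (Fin n → Fin I) → ℝ := fun z => φ (∑ s, boolVal (ρ s) * α (z s)) with hf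
  have hmono : SwapMonotone ρ (fiberSum m D f) := by
    refine swapMonotone_fiberSum fun z s s' hs' hs hρ => hφ ?_
    have h1 := sum_mul_comp_swap (fun t => boolVal (ρ t)) (fun t => α (z t)) s s'
    simp only [Function.comp] at h1 ⊢
    rw [h1]
    have h2 := hα (hD _ _ hs hs')
    have h3 : 0 ≤ boolVal (ρ s) - boolVal (ρ s') := by
      cases h4 : ρ s <;> cases h5 : ρ s' <;> simp_all
    nlinarith [mul_nonneg h3 (sub_nonneg.2 h2)]
  obtain ⟨c, hc, hN⟩ : ∃ c : ℝ, 0 ≤ c ∧ ∀ b ∈ layer (Fin n) a,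
      fiberSum m D (fun _ => 1) b = c := by
    rcases (layer (Fin n) a).eq_empty_or_nonempty with he | ⟨b₀, hb₀⟩
    · exact ⟨0, le_rfl, by simp [he]⟩
    refine ⟨fiberSum m D (fun _ => 1) b₀, Finset.sum_nonneg fun _ _ => zero_le_one, ?_⟩
    intro b hb
    have hl : level (fun _ => true) b = level (fun _ => true) b₀ :=
      (Finset.mem_filter.1 hb).2.trans (Finset.mem_filter.1 hb₀).2.symm
    exact (swapMonotone_fiberSum (ρ := fun _ => true) fun _ _ _ _ _ _ => le_rfl).eq_of_level_eq
      hl hl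
  have hsum : ∀ G : (Fin n → Bool) → ℝ,
      ∑ z ∈ marginSet n m, G (D ∘ z) = (∑ b ∈ layer (Fin n) a, G b) * c := by
    intro G
    have := sum_marginSet_eq m D G (fun _ => 1)
    simp only [mul_one] at this
    rw [this, Finset.sum_mul]
    exact Finset.sum_congr rfl fun b hb => by rw [hN b hb]
  have e1 := sum_marginSet_eq m D (expWeight θ) f
  have e2 := sum_marginSet_eq m D (fun b => Real.exp (γ * level ρ b)) f
  have e3 := hsum (expWeight θ)
  have e4 := hsum (fun b => Real.exp (γ * level ρ b))
  have key := layer_sum_le hθ hmono a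
  simp only [expWeight, level, Function.comp] at e1 e2 e3 e4 key ⊢
  rw [e1, e2, e3, e4]
  nlinarith [mul_le_mul_of_nonneg_right key hc]

/-- Double counting of the pairs of an assignment with given margins and a set of `d` subjects
with given numbers of each treatment. -/
lemma choose_mul_card_cellCount {n I : ℕ} (m : Fin I → ℕ) (r : Fin n → Fin 2) (t : Fin I → ℕ)
    (ht : ∑ i, t i = outcomeMargin r 1) :
    n.choose (outcomeMargin r 1) *
        ((marginSet n m).filter fun z => ∀ i, cellCount z r i 1 = t i).card =
      (marginSet n m).card * ∏ i, (m i).choose (t i) := by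
  set d := outcomeMargin r 1 with hd
  set R₀ : Finset (Fin n) := Finset.univ.filter fun s => r s = 1 with hR₀
  have hcell : ∀ z : Fin n → Fin I, ∀ i,
      cellCount z r i 1 = (R₀.filter fun s => z s = i).card := by
    intro z i
    rw [cellCount, hR₀, Finset.filter_filter]
    congr 1
    ext s
    simp [and_comm]
  have h1 : ∀ R ∈ Finset.powersetCard d (Finset.univ : Finset (Fin n)),
      ((marginSet n m).filter fun z => ∀ i, (R.filter fun s => z s = i).card = t i).card =
      ((marginSet n m).filter fun z => ∀ i, cellCount z r i 1 = t i).card := by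
    intro R hR
    have hRc : R.card = R₀.card := (Finset.mem_powersetCard.1 hR).2
    let e : {x // x ∈ R₀} ≃ {x // x ∈ R} := Finset.equivOfCardEq hRc.symm
    let σ : Equiv.Perm (Fin n) := e.extendSubtype
    have hσ : ∀ s, σ s ∈ R ↔ s ∈ R₀ := by
      intro s
      constructor
      · intro h
        by_contra h'
        exact e.extendSubtype_not_mem s h' h
      · exact e.extendSubtype_mem s
    have hcard : ∀ z : Fin n → Fin I, ∀ i, (R.filter fun s => z s = i).card =
        (R₀.filter fun s => (z ∘ σ) s = i).card := by
      intro z i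
      refine Finset.card_bij' (fun s _ => σ.symm s) (fun s _ => σ s) ?_ ?_ ?_ ?_
      · intro s hs
        have := hσ (σ.symm s)
        simp_all
      · intro s hs
        have := hσ s
        simp_all
      · simp
      · simp
    refine Finset.card_bij' (fun z _ => z ∘ σ) (fun z _ => z ∘ σ.symm) ?_ ?_ ?_ ?_
    · intro z hz
      rw [Finset.mem_filter] at hz ⊢
      refine ⟨comp_perm_mem_marginSet hz.1 _, fun i => ?_⟩
      rw [hcell, ← hcard, hz.2]
    · intro z hz
      rw [Finset.mem_filter] at hz ⊢
      refine ⟨comp_perm_mem_marginSet hz.1 _, fun i => ?_⟩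
      rw [hcard, ← hz.2, hcell]
      simp
    · intro z _; funext s; simp
    · intro z _; funext s; simp
  have h2 : ∀ z ∈ marginSet n m,
      ((Finset.powersetCard d (Finset.univ : Finset (Fin n))).filter
        fun R => ∀ i, (R.filter fun s => z s = i).card = t i).card =
      ∏ i, (m i).choose (t i) := by
    intro z hz
    rw [mem_marginSet] at hz
    have : ∏ i, (m i).choose (t i) = (Fintype.piFinset fun i =>
        Finset.powersetCard (t i) (Finset.univ.filter fun s => z s = i)).card := by
      rw [Fintype.card_piFinset]
      refine Finset.prod_congr rfl fun i _ => ?_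
      rw [Finset.card_powersetCard, ← hz i]; rfl
    rw [this]
    refine Finset.card_bij' (fun R _ i => R.filter fun s => z s = i)
      (fun F _ => Finset.univ.filter fun s => s ∈ F (z s)) ?_ ?_ ?_ ?_
    · intro R hR
      rw [Finset.mem_filter] at hR
      rw [Fintype.mem_piFinset]
      intro i
      rw [Finset.mem_powersetCard]
      exact ⟨Finset.filter_subset_filter _ (Finset.subset_univ _), hR.2 i⟩
    · intro F hF
      rw [Fintype.mem_piFinset] at hF
      simp only [Finset.mem_powersetCard] at hF
      have hFi : ∀ i, ((Finset.univ.filter fun s => s ∈ F (z s)).filter fun s => z s = i) =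
          F i := by
        intro i
        ext s
        simp only [Finset.mem_filter, Finset.mem_univ, true_and]
        constructor
        · rintro ⟨h, rfl⟩; exact h
        · intro h
          have := (hF i).1 h
          simp only [Finset.mem_filter, Finset.mem_univ, true_and] at this
          subst this
          exact ⟨h, rfl⟩
      rw [Finset.mem_filter, Finset.mem_powersetCard]
      refine ⟨⟨Finset.subset_univ _, ?_⟩, fun i => by rw [hFi, (hF i).2]⟩
      rw [Finset.card_eq_sum_card_fiberwise (f := z) (t := Finset.univ) (by simp), ← ht]
      exact Finset.sum_congr rfl fun i _ => by rw [hFi, (hF i).2]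
    · intro R _
      ext s; simp
    · intro F hF
      rw [Fintype.mem_piFinset] at hF
      funext i
      ext s
      simp only [Finset.mem_filter, Finset.mem_univ, true_and]
      constructor
      · rintro ⟨h, rfl⟩; exact h
      · intro h
        have := (Finset.mem_powersetCard.1 (hF i)).1 h
        simp only [Finset.mem_filter, Finset.mem_univ, true_and] at this
        subst this
        exact ⟨h, rfl⟩
  have h3 : ∑ R ∈ Finset.powersetCard d (Finset.univ : Finset (Fin n)),
      ((marginSet n m).filter fun z => ∀ i, (R.filter fun s => z s = i).card = t i).card =
      ∑ z ∈ marginSet n m, ((Finset.powersetCard d (Finset.univ : Finset (Fin n))).filter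
        fun R => ∀ i, (R.filter fun s => z s = i).card = t i).card :=
    Finset.sum_card_bipartiteAbove_eq_sum_card_bipartiteBelow _
  rw [Finset.sum_congr rfl h1, Finset.sum_congr rfl h2] at h3
  simpa using h3

lemma sum_cellCount {n I J : ℕ} (z : Fin n → Fin I) (r : Fin n → Fin J) (j : Fin J) :
    ∑ i, cellCount z r i j = outcomeMargin r j := by
  rw [outcomeMargin, Finset.card_eq_sum_card_fiberwise (f := z) (t := Finset.univ) (by simp)]
  refine Finset.sum_congr rfl fun i _ => ?_
  rw [cellCount, Finset.filter_filter]
  congr 1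
  ext s
  simp [and_comm]

lemma choose_mul_sum_marginSet {n I : ℕ} (m : Fin I → ℕ) (r : Fin n → Fin 2)
    (G : (Fin I → ℕ) → ℝ) :
    (n.choose (outcomeMargin r 1) : ℝ) * ∑ z ∈ marginSet n m, G (fun i => cellCount z r i 1) =
      (marginSet n m).card * ∑ t ∈ Finset.piAntidiag Finset.univ (outcomeMargin r 1),
        (∏ i, ((m i).choose (t i) : ℝ)) * G t := by
  rw [← Finset.sum_fiberwise_of_maps_to (s := marginSet n m)
    (g := fun z i => cellCount z r i 1)
    (t := Finset.piAntidiag Finset.univ (outcomeMargin r 1)), Finset.mul_sum, Finset.mul_sum]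
  · refine Finset.sum_congr rfl fun t ht => ?_
    have h := choose_mul_card_cellCount m r t (by simpa [Finset.mem_piAntidiag] using ht)
    rw [Finset.sum_congr rfl (g := fun _ => G t)]
    · have h' : (n.choose (outcomeMargin r 1) : ℝ) *
          ((marginSet n m).filter fun z => ∀ i, cellCount z r i 1 = t i).card =
          (marginSet n m).card * ∏ i, ((m i).choose (t i) : ℝ) := by exact_mod_cast h
      rw [Finset.sum_const, nsmul_eq_mul, ← mul_assoc, ← mul_assoc, ← h']
      simp only [funext_iff]
    · intro z hz
      rw [(Finset.mem_filter.1 hz).2]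
  · intro z _
    simp [Finset.mem_piAntidiag, sum_cellCount]

lemma outcomeMargin_le {n J : ℕ} (r : Fin n → Fin J) (j : Fin J) : outcomeMargin r j ≤ n :=
  (Finset.card_le_univ _).trans_eq (Fintype.card_fin n)

lemma prod_choose_mul_exp {I : ℕ} (m t : Fin I → ℕ) (w : Fin I → ℝ) :
    ∏ i, ((m i).choose (t i) : ℝ) * Real.exp (w i * t i) =
      (∏ i, ((m i).choose (t i) : ℝ)) * Real.exp (∑ i, w i * t i) := by
  rw [Finset.prod_mul_distrib, Real.exp_sum]

/-- The expectation of a function of an extended hypergeometric vector is the expectation of the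
function of the cell counts under the exponential tilt along the outcome. -/
lemma sum_extHypergeomMass_mul {n I : ℕ} (m : Fin I → ℕ) (hne : (marginSet n m).Nonempty)
    (r : Fin n → Fin 2) (w α : Fin I → ℝ) (φ : ℝ → ℝ) :
    ∑ t ∈ Finset.piAntidiag Finset.univ (outcomeMargin r 1),
        extHypergeomMass m (outcomeMargin r 1) w t * φ (∑ i, α i * t i) =
      (∑ z ∈ marginSet n m, Real.exp (∑ s, boolVal (decide (r s = 1)) * w (z s)) *
        φ (∑ s, boolVal (decide (r s = 1)) * α (z s))) /
      ∑ z ∈ marginSet n m, Real.exp (∑ s, boolVal (decide (r s = 1)) * w (z s)) := by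
  have h1 := choose_mul_sum_marginSet m r
    (fun t => Real.exp (∑ i, w i * t i) * φ (∑ i, α i * t i))
  have h2 := choose_mul_sum_marginSet m r (fun t => Real.exp (∑ i, w i * t i))
  simp only [sum_mul_cellCount] at h1 h2
  have hc : (0 : ℝ) < n.choose (outcomeMargin r 1) :=
    Nat.cast_pos.2 (Nat.choose_pos (outcomeMargin_le r 1))
  have hZ : (0 : ℝ) < (marginSet n m).card := Nat.cast_pos.2 (Finset.card_pos.2 hne)
  have hV : 0 < ∑ z ∈ marginSet n m, Real.exp (∑ s, boolVal (decide (r s = 1)) * w (z s)) :=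
    Finset.sum_pos (fun _ _ => Real.exp_pos _) hne
  set A := ∑ t ∈ Finset.piAntidiag Finset.univ (outcomeMargin r 1),
    (∏ i, ((m i).choose (t i) : ℝ)) * (Real.exp (∑ i, w i * t i) * φ (∑ i, α i * t i))
  set B := ∑ t ∈ Finset.piAntidiag Finset.univ (outcomeMargin r 1),
    (∏ i, ((m i).choose (t i) : ℝ)) * Real.exp (∑ i, w i * t i) with hB
  have hBpos : 0 < B := by
    refine pos_of_mul_pos_right ?_ hZ.le
    rw [← h2]
    exact mul_pos hc hV
  have hleft : ∑ t ∈ Finset.piAntidiag Finset.univ (outcomeMargin r 1),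
      extHypergeomMass m (outcomeMargin r 1) w t * φ (∑ i, α i * t i) = A / B := by
    rw [Finset.sum_div]
    refine Finset.sum_congr rfl fun t ht => ?_
    have ht' : ∑ i, t i = outcomeMargin r 1 := by simpa [Finset.mem_piAntidiag] using ht
    simp only [extHypergeomMass, if_pos ht', prod_choose_mul_exp, ← hB]
    ring
  rw [hleft, div_eq_div_iff hBpos.ne' hV.ne']
  refine mul_left_cancel₀ (mul_pos hc hZ).ne' ?_
  linear_combination A * (marginSet n m).card * h2 - (marginSet n m).card * B * h1

lemma genericBiasProb_nonneg {I : ℕ} {X : Type*} (ξ : Fin I → X → ℝ) (δ : Fin I → ℝ) (γ : ℝ)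
    (x : X) (u : ℝ) (i : Fin I) : 0 ≤ genericBiasProb ξ δ γ x u i :=
  div_nonneg (Real.exp_pos _).le (Finset.sum_nonneg fun _ _ => (Real.exp_pos _).le)

/-- Given the treatment margins, the observed covariate cancels. -/
lemma exists_prod_genericBiasProb_eq {n I : ℕ} {X : Type*} (ξ : Fin I → X → ℝ) (δ : Fin I → ℝ)
    (γ : ℝ) {x : Fin n → X} (hx : ∀ s s', x s = x s') (u : Fin n → ℝ) (m : Fin I → ℕ)
    (hne : (marginSet n m).Nonempty) :
    ∃ C : ℝ, 0 < C ∧ ∀ z ∈ marginSet n m, ∏ s, genericBiasProb ξ δ γ (x s) (u s) (z s) =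
      C * Real.exp (∑ s, γ * u s * δ (z s)) := by
  obtain ⟨c, hc⟩ : ∃ c : Fin I → ℝ, ∀ s i, ξ i (x s) = c i := by
    rcases isEmpty_or_nonempty (Fin n) with h | ⟨⟨s₀⟩⟩
    · exact ⟨0, fun s => h.elim s⟩
    · exact ⟨fun i => ξ i (x s₀), fun s i => by rw [hx s s₀]⟩
  obtain ⟨z₀, -⟩ := hne
  refine ⟨Real.exp (∑ i, c i * m i) / ∏ s, ∑ i, Real.exp (ξ i (x s) + γ * δ i * u s), ?_, ?_⟩
  · refine div_pos (Real.exp_pos _) (Finset.prod_pos fun s _ => ?_)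
    exact Finset.sum_pos (fun _ _ => Real.exp_pos _) ⟨z₀ s, Finset.mem_univ _⟩
  · intro z hz
    rw [mem_marginSet] at hz
    unfold genericBiasProb
    rw [Finset.prod_div_distrib, ← Real.exp_sum, Finset.sum_add_distrib, Real.exp_add]
    have h1 : ∑ s, ξ (z s) (x s) = ∑ i, c i * m i := by
      simp only [hc]
      rw [sum_comp_eq_sum_treatmentMargin]
      simp only [hz]
    have h2 : ∑ s, γ * δ (z s) * u s = ∑ s, γ * u s * δ (z s) :=
      Finset.sum_congr rfl fun s _ => by ring
    rw [h1, h2]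
    ring

/-- Stochastic dominance in a single stratum. -/
lemma stratum_dominance {n I : ℕ} {X : Type*} {δ : Fin I → ℝ} (hδ01 : ∀ i, δ i = 0 ∨ δ i = 1)
    (hδ : Monotone δ) {γ₀ γ : ℝ} (hγ₀ : 0 ≤ γ₀) (hγ : γ₀ ≤ γ) (ξ : Fin I → X → ℝ)
    {x : Fin n → X} (hx : ∀ s s', x s = x s') {u : Fin n → ℝ}
    (hu : ∀ s, u s ∈ Set.Icc (0 : ℝ) 1) {m : Fin I → ℕ} (hne : (marginSet n m).Nonempty)
    (r : Fin n → Fin 2) {α : Fin I → ℝ} (hα : Monotone α) {φ : ℝ → ℝ} (hφ : Monotone φ) :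
    ∑ z ∈ marginSet n m, (∏ s, genericBiasProb ξ δ γ₀ (x s) (u s) (z s)) /
        (∑ z ∈ marginSet n m, ∏ s, genericBiasProb ξ δ γ₀ (x s) (u s) (z s)) *
          φ (signScore α z r) ≤
      ∑ t ∈ Finset.piAntidiag Finset.univ (outcomeMargin r 1),
        extHypergeomMass m (outcomeMargin r 1) (fun i => γ * δ i) t * φ (∑ i, α i * t i) := by
  obtain ⟨C, hC, hprob⟩ := exists_prod_genericBiasProb_eq ξ δ γ₀ hx u m hne
  rw [sum_extHypergeomMass_mul m hne, Finset.sum_congr rfl hprob, ← Finset.mul_sum]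
  have hW : 0 < ∑ z ∈ marginSet n m, Real.exp (∑ s, γ₀ * u s * δ (z s)) :=
    Finset.sum_pos (fun _ _ => Real.exp_pos _) hne
  have hleft : ∑ z ∈ marginSet n m, (∏ s, genericBiasProb ξ δ γ₀ (x s) (u s) (z s)) /
        (C * ∑ z ∈ marginSet n m, Real.exp (∑ s, γ₀ * u s * δ (z s))) *
          φ (signScore α z r) =
      (∑ z ∈ marginSet n m, Real.exp (∑ s, γ₀ * u s * δ (z s)) *
        φ (∑ s, boolVal (decide (r s = 1)) * α (z s))) /
      ∑ z ∈ marginSet n m, Real.exp (∑ s, γ₀ * u s * δ (z s)) := by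
    rw [Finset.sum_div]
    refine Finset.sum_congr rfl fun z hz => ?_
    rw [hprob z hz, signScore, sum_mul_cellCount, mul_div_mul_left _ _ hC.ne']
    ring
  rw [hleft, div_le_div_iff₀ hW (Finset.sum_pos (fun _ _ => Real.exp_pos _) hne)]
  have hD : ∀ i, δ i = boolVal (decide (δ i = 1)) := by
    intro i
    rcases hδ01 i with h | h <;> simp [h]
  have key := tilted_sum_le m (D := fun i => decide (δ i = 1)) ?_ (θ := fun s => γ₀ * u s)
    (γ := γ) ?_ (fun s => decide (r s = 1)) hα hφ
  · simp only [← hD] at key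
    convert key using 6
    all_goals first
      | (rw [Finset.mul_sum]; exact Finset.sum_congr rfl fun s _ => by ring)
      | rfl
  · intro i j hi hj
    by_contra h
    have := hδ (not_le.1 h).le
    simp only [decide_eq_false_iff_not, decide_eq_true_eq] at hi hj
    rw [hj, (hδ01 i).resolve_right hi] at this
    linarith
  · intro s
    obtain ⟨h1, h2⟩ := hu s
    constructor <;> nlinarith

lemma sum_piFinset_succ {K : ℕ} {A : Fin (K + 1) → Type*} (s : ∀ k, Finset (A k))
    (F : (∀ k, A k) → ℝ) :
    ∑ x ∈ Fintype.piFinset s, F x =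
      ∑ x₀ ∈ s 0, ∑ x' ∈ Fintype.piFinset (fun k : Fin K => s k.succ), F (Fin.cons x₀ x') := by
  rw [← Finset.sum_product']
  refine Finset.sum_bij' (fun x _ => (x 0, Fin.tail x)) (fun p _ => Fin.cons p.1 p.2)
    ?_ ?_ ?_ ?_ ?_
  · intro x hx
    rw [Fin.mem_piFinset_iff_zero_tail] at hx
    exact Finset.mem_product.2 hx
  · intro p hp
    rw [Fin.mem_piFinset_iff_zero_tail]
    simpa [Fin.tail] using Finset.mem_product.1 hp
  · intro x _; simp
  · intro p _; simp
  · intro x _; simp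

/-- Stochastic dominance of the coordinates of independent vectors implies dominance of every
nondecreasing function of the vectors. -/
lemma sum_piFinset_dominance {K : ℕ} {A B : Fin K → Type*} (sA : ∀ k, Finset (A k))
    (sB : ∀ k, Finset (B k)) (a : ∀ k, A k → ℝ) (b : ∀ k, B k → ℝ)
    (ha : ∀ k x, x ∈ sA k → 0 ≤ a k x) (hb : ∀ k y, y ∈ sB k → 0 ≤ b k y)
    (T : ∀ k, A k → ℝ) (U : ∀ k, B k → ℝ)
    (h : ∀ k, ∀ φ : ℝ → ℝ, Monotone φ →
      ∑ x ∈ sA k, a k x * φ (T k x) ≤ ∑ y ∈ sB k, b k y * φ (U k y))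
    (G : (Fin K → ℝ) → ℝ) (hG : Monotone G) :
    ∑ x ∈ Fintype.piFinset sA, (∏ k, a k (x k)) * G (fun k => T k (x k)) ≤
      ∑ y ∈ Fintype.piFinset sB, (∏ k, b k (y k)) * G (fun k => U k (y k)) := by
  induction K with
  | zero =>
    simp only [Fintype.piFinset_of_isEmpty, Finset.univ_unique, Finset.sum_singleton,
      Finset.univ_eq_empty, Finset.prod_empty, one_mul]
    exact (congrArg G (Subsingleton.elim _ _)).le
  | succ K ih =>
    have hcons : ∀ (v : ℝ) (f : Fin (K + 1) → ℝ), f 0 = v →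
        f = Fin.cons v (fun k : Fin K => f k.succ) := by
      intro v f hf
      rw [← hf]
      exact (Fin.cons_self_tail f).symm
    have mono_tail : ∀ v : ℝ, Monotone fun f : Fin K → ℝ =>
        G (Fin.cons (α := fun _ => ℝ) v f) := by
      intro v f f' hff
      exact hG (Fin.cons_le_cons.2 ⟨le_rfl, hff⟩)
    calc ∑ x ∈ Fintype.piFinset sA, (∏ k, a k (x k)) * G (fun k => T k (x k))
        = ∑ x₀ ∈ sA 0, a 0 x₀ * ∑ x' ∈ Fintype.piFinset (fun k => sA k.succ),
            (∏ k, a k.succ (x' k)) *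
              G (Fin.cons (α := fun _ => ℝ) (T 0 x₀) fun k => T k.succ (x' k)) := by
          rw [sum_piFinset_succ]
          refine Finset.sum_congr rfl fun x₀ _ => ?_
          rw [Finset.mul_sum]
          refine Finset.sum_congr rfl fun x' _ => ?_
          rw [Fin.prod_univ_succ, ← mul_assoc,
            hcons (T 0 x₀) (fun k => T k ((Fin.cons x₀ x' : ∀ k, A k) k)) rfl]
          simp
      _ ≤ ∑ x₀ ∈ sA 0, a 0 x₀ * ∑ y' ∈ Fintype.piFinset (fun k => sB k.succ),
            (∏ k, b k.succ (y' k)) *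
              G (Fin.cons (α := fun _ => ℝ) (T 0 x₀) fun k => U k.succ (y' k)) := by
          refine Finset.sum_le_sum fun x₀ hx₀ => mul_le_mul_of_nonneg_left ?_ (ha 0 x₀ hx₀)
          exact ih (fun k => sA k.succ) (fun k => sB k.succ) (fun k => a k.succ)
            (fun k => b k.succ) (fun k => ha k.succ) (fun k => hb k.succ) (fun k => T k.succ)
            (fun k => U k.succ) (fun k => h k.succ) _ (mono_tail (T 0 x₀))
      _ ≤ ∑ y₀ ∈ sB 0, b 0 y₀ * ∑ y' ∈ Fintype.piFinset (fun k => sB k.succ),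
            (∏ k, b k.succ (y' k)) *
              G (Fin.cons (α := fun _ => ℝ) (U 0 y₀) fun k => U k.succ (y' k)) := by
          refine h 0 (fun v => ∑ y' ∈ Fintype.piFinset (fun k => sB k.succ),
            (∏ k, b k.succ (y' k)) *
              G (Fin.cons (α := fun _ => ℝ) v fun k => U k.succ (y' k))) ?_
          intro v v' hv
          refine Finset.sum_le_sum fun y' hy' => mul_le_mul_of_nonneg_left ?_
            (Finset.prod_nonneg fun k _ => hb k.succ _ (Fintype.mem_piFinset.1 hy' k))
          exact hG (Fin.cons_le_cons.2 ⟨hv, le_rfl⟩)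
      _ = ∑ y ∈ Fintype.piFinset sB, (∏ k, b k (y k)) * G (fun k => U k (y k)) := by
          rw [sum_piFinset_succ]
          refine Finset.sum_congr rfl fun y₀ _ => ?_
          rw [Finset.mul_sum]
          refine Finset.sum_congr rfl fun y' _ => ?_
          rw [Fin.prod_univ_succ, ← mul_assoc,
            hcons (U 0 y₀) (fun k => U k ((Fin.cons y₀ y' : ∀ k, B k) k)) rfl]
          simp

lemma FollowsGenericBias.real_joint {Ω : Type*} [MeasurableSpace Ω] {P : Measure Ω}
    {K I : ℕ} {n : Fin K → ℕ} {X : Type*} {Z : (k : Fin K) → Fin (n k) → Ω → Fin I}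
    {ξ : Fin I → X → ℝ} {δ : Fin I → ℝ} {γ : ℝ} {x : (k : Fin K) → Fin (n k) → X}
    {u : (k : Fin K) → Fin (n k) → ℝ} (hZ : FollowsGenericBias P Z ξ δ γ x u)
    (ζ : ∀ k, Fin (n k) → Fin I) :
    P.real ((fun ω k s => Z k s ω) ⁻¹' {ζ}) =
      ∏ k, ∏ s, genericBiasProb ξ δ γ (x k s) (u k s) (ζ k s) := by
  have h := hZ.indep.measure_inter_preimage_eq_mul Finset.univ
    (sets := fun ks : (Σ k, Fin (n k)) => {ζ ks.1 ks.2}) (fun _ _ => measurableSet_singleton _)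
  have hset : (⋂ ks ∈ (Finset.univ : Finset (Σ k, Fin (n k))),
      (fun ω => Z ks.1 ks.2 ω) ⁻¹' {ζ ks.1 ks.2}) = (fun ω k s => Z k s ω) ⁻¹' {ζ} := by
    ext ω
    simp only [Finset.mem_univ, Set.iInter_true, Set.mem_iInter, Set.mem_preimage,
      Set.mem_singleton_iff, funext_iff]
    exact ⟨fun h k s => h ⟨k, s⟩, fun h ks => h ks.1 ks.2⟩
  rw [← hset, measureReal_def, h, ENNReal.toReal_prod, Fintype.prod_sigma]
  refine Finset.prod_congr rfl fun k _ => Finset.prod_congr rfl fun s _ => ?_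
  exact hZ.prob k s (ζ k s)

lemma HasExtHypergeomLaw.real_joint {Ω : Type*} [MeasurableSpace Ω] {Q : Measure Ω}
    {K I : ℕ} {M : Fin K → Ω → Fin I → ℕ} (hMindep : iIndepFun M Q) {m : Fin K → Fin I → ℕ}
    {d : Fin K → ℕ} {w : Fin I → ℝ} (hM : ∀ k, HasExtHypergeomLaw Q (M k) (m k) (d k) w)
    (t : Fin K → Fin I → ℕ) :
    Q.real ((fun ω k => M k ω) ⁻¹' {t}) = ∏ k, extHypergeomMass (m k) (d k) w (t k) := by
  have h := hMindep.measure_inter_preimage_eq_mul Finset.univ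
    (sets := fun k => {t k}) (fun _ _ => measurableSet_singleton _)
  have hset : (⋂ k ∈ (Finset.univ : Finset (Fin K)), M k ⁻¹' {t k}) =
      (fun ω k => M k ω) ⁻¹' {t} := by
    ext ω
    simp [funext_iff]
  rw [← hset, measureReal_def, h, ENNReal.toReal_prod]
  exact Finset.prod_congr rfl fun k _ => (hM k).mass (t k)

lemma extHypergeomMass_nonneg {I : ℕ} (m : Fin I → ℕ) (d : ℕ) (w : Fin I → ℝ)
    (t : Fin I → ℕ) : 0 ≤ extHypergeomMass m d w t := by
  unfold extHypergeomMass
  split_ifs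
  · exact div_nonneg (by positivity) (by positivity)
  · exact le_rfl

lemma FollowsGenericBias.measurableSet_preimage {Ω : Type*} [MeasurableSpace Ω] {P : Measure Ω}
    {K I : ℕ} {n : Fin K → ℕ} {X : Type*} {Z : (k : Fin K) → Fin (n k) → Ω → Fin I}
    {ξ : Fin I → X → ℝ} {δ : Fin I → ℝ} {γ : ℝ} {x : (k : Fin K) → Fin (n k) → X}
    {u : (k : Fin K) → Fin (n k) → ℝ} (hZ : FollowsGenericBias P Z ξ δ γ x u)
    (A : Set (∀ k, Fin (n k) → Fin I)) : MeasurableSet ((fun ω k s => Z k s ω) ⁻¹' A) :=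
  (measurable_pi_lambda _ fun k => measurable_pi_lambda _ fun s => hZ.measurable_treatment k s)
    A.toFinite.measurableSet

theorem mainTheorem7 {K I : ℕ} {n : Fin K → ℕ}
    {Ω : Type*} [MeasurableSpace Ω] (P : Measure Ω) [IsProbabilityMeasure P]
    {Ω' : Type*} [MeasurableSpace Ω'] (Q : Measure Ω') [IsProbabilityMeasure Q]
    {X : Type*}
    -- treatment levels sensitive to the unmeasured confounder, and the bound on the bias
    (δ : Fin I → ℝ) (hδ01 : ∀ i, δ i = 0 ∨ δ i = 1) (hδ : Monotone δ)
    (γ₀ γ : ℝ) (hγ₀ : 0 ≤ γ₀) (hγ : γ₀ ≤ γ)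
    -- treatment assignment with actual sensitivity parameter `γ₀`
    (ξ : Fin I → X → ℝ) (x : (k : Fin K) → Fin (n k) → X) (u : (k : Fin K) → Fin (n k) → ℝ)
    (Z : (k : Fin K) → Fin (n k) → Ω → Fin I) (hZ : FollowsGenericBias P Z ξ δ γ₀ x u)
    -- potential outcomes satisfying the joint sharp null hypothesis
    (Y : (k : Fin K) → Fin (n k) → Fin I → Fin 2) (r : (k : Fin K) → Fin (n k) → Fin 2)
    (hnull : ∀ k s i, Y k s i = r k s)
    -- the treatment margins conditioned on
    (m : Fin K → Fin I → ℕ) (hm : ∀ k, ∑ i, m k i = n k)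
    -- scores of the sign-score statistics
    (α : Fin K → Fin I → ℝ) (hα : ∀ k, Monotone (α k))
    -- independent multivariate extended hypergeometric vectors
    (M : Fin K → Ω' → Fin I → ℕ) (hMindep : iIndepFun M Q)
    (hM : ∀ k, HasExtHypergeomLaw Q (M k) (m k) (outcomeMargin (r k) 1) (fun i => γ * δ i))
    (g : (Fin K → ℝ) → ℝ) (hg : Monotone g) :
    ∀ c : ℝ,
      (cond P (marginEvent Z m)).real
          {ω | c ≤ g fun k =>
            signScore (α k) (fun s => Z k s ω) (observedOutcome (Y k) fun s => Z k s ω)} ≤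
        Q.real {ω' | c ≤ g fun k => ∑ i, α k i * (M k ω' i : ℝ)} := by
  classical
  intro c
  have hobs : ∀ k (z : Fin (n k) → Fin I), observedOutcome (Y k) z = r k :=
    fun k z => funext fun s => hnull k s (z s)
  simp only [hobs]
  set sA : ∀ k, Finset (Fin (n k) → Fin I) := fun k => marginSet (n k) (m k) with hsA
  set sB : Fin K → Finset (Fin I → ℕ) :=
    fun k => Finset.piAntidiag Finset.univ (outcomeMargin (r k) 1) with hsB
  set p : ∀ k, (Fin (n k) → Fin I) → ℝ :=
    fun k z => ∏ s, genericBiasProb ξ δ γ₀ (x k s) (u k s) (z s) with hp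
  have hp0 : ∀ k z, 0 ≤ p k z :=
    fun k z => Finset.prod_nonneg fun s _ => genericBiasProb_nonneg _ _ _ _ _ _
  set ζ : Ω → ∀ k, Fin (n k) → Fin I := fun ω k s => Z k s ω with hζ
  set G : (Fin K → ℝ) → ℝ := fun v => if c ≤ g v then 1 else 0 with hG
  have hGmono : Monotone G := by
    intro v w hvw
    simp only [hG]
    split_ifs with h1 h2 h2
    · exact le_rfl
    · exact absurd (h1.trans (hg hvw)) h2
    · exact zero_le_one
    · exact le_rfl
  have hE : marginEvent Z m = ζ ⁻¹' (Fintype.piFinset sA) := by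
    ext ω
    simp [marginEvent, hsA, mem_marginSet, hζ]
  have hPE : P.real (marginEvent Z m) = ∏ k, ∑ z ∈ sA k, p k z := by
    rw [hE, ← sum_measureReal_preimage_singleton _ fun y _ => hZ.measurableSet_preimage {y},
      Finset.prod_univ_sum]
    exact Finset.sum_congr rfl fun y _ => hZ.real_joint y
  have hPT : P.real (marginEvent Z m ∩
      {ω | c ≤ g fun k => signScore (α k) (fun s => Z k s ω) (r k)}) =
      ∑ z ∈ Fintype.piFinset sA,
        (∏ k, p k (z k)) * G fun k => signScore (α k) (z k) (r k) := by
    have hset : marginEvent Z m ∩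
        {ω | c ≤ g fun k => signScore (α k) (fun s => Z k s ω) (r k)} =
        ζ ⁻¹' ((Fintype.piFinset sA).filter
          fun z => c ≤ g fun k => signScore (α k) (z k) (r k)) := by
      rw [hE]
      ext ω
      simp [hζ]
    rw [hset, ← sum_measureReal_preimage_singleton _ fun y _ => hZ.measurableSet_preimage {y},
      Finset.sum_filter]
    refine Finset.sum_congr rfl fun y _ => ?_
    rw [hZ.real_joint y]
    simp only [hG, mul_ite, mul_one, mul_zero]
    rfl
  have hQT : ∑ t ∈ Fintype.piFinset sB,
      (∏ k, extHypergeomMass (m k) (outcomeMargin (r k) 1) (fun i => γ * δ i) (t k)) *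
        (G fun k => ∑ i, α k i * (t k i : ℝ)) ≤
      Q.real {ω' | c ≤ g fun k => ∑ i, α k i * (M k ω' i : ℝ)} := by
    have hmeas : Measurable fun ω k => M k ω :=
      measurable_pi_lambda _ fun k => (hM k).measurable
    have hsub : (fun ω k => M k ω) ⁻¹' ((Fintype.piFinset sB).filter
        fun t => c ≤ g fun k => ∑ i, α k i * (t k i : ℝ)) ⊆
        {ω' | c ≤ g fun k => ∑ i, α k i * (M k ω' i : ℝ)} := by
      intro ω hω
      simpa using (Finset.mem_filter.1 (Finset.mem_coe.1 hω)).2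
    refine le_trans (le_of_eq ?_) (measureReal_mono hsub)
    rw [← sum_measureReal_preimage_singleton _ fun y _ => hmeas (measurableSet_singleton y),
      Finset.sum_filter]
    refine Finset.sum_congr rfl fun t _ => ?_
    rw [HasExtHypergeomLaw.real_joint hMindep hM t]
    simp only [hG, mul_ite, mul_one, mul_zero]
  have hEmeas : MeasurableSet (marginEvent Z m) := hE ▸ hZ.measurableSet_preimage _
  rw [measureReal_def, cond_apply hEmeas, ENNReal.toReal_mul, ENNReal.toReal_inv,
    ← measureReal_def, ← measureReal_def, hPT, hPE]
  by_cases hne : ∀ k, (sA k).Nonempty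
  · refine le_trans ?_ hQT
    have key := sum_piFinset_dominance sA sB (fun k z => p k z / ∑ z ∈ sA k, p k z)
      (fun k => extHypergeomMass (m k) (outcomeMargin (r k) 1) (fun i => γ * δ i))
      (fun k z _ => div_nonneg (hp0 k z) (Finset.sum_nonneg fun z _ => hp0 k z))
      (fun k t _ => extHypergeomMass_nonneg _ _ _ t)
      (fun k z => signScore (α k) z (r k)) (fun k t => ∑ i, α k i * (t i : ℝ))
      (fun k φ hφ => stratum_dominance hδ01 hδ hγ₀ hγ ξ (hZ.same_covariate k)
        (hZ.unobserved_mem k) (hne k) (r k) (hα k) hφ) G hGmono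
    refine le_trans (le_of_eq ?_) key
    rw [Finset.mul_sum]
    refine Finset.sum_congr rfl fun z _ => ?_
    rw [Finset.prod_div_distrib]
    ring
  · push Not at hne
    obtain ⟨k, hk⟩ := hne
    have : ∏ k, ∑ z ∈ sA k, p k z = 0 :=
      Finset.prod_eq_zero (Finset.mem_univ k) (by rw [hk, Finset.sum_empty])
    rw [this, inv_zero, zero_mul]
    exact measureReal_nonneg
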